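/- An \emph{abstract state space} $(A,\Omega_A,u_A)$ consists of a finite-dimensional real vector space $A$, a compact convex set $\Omega_A\subset A$ of (normalized) states such that $A_+:=\mathbb R_{\ge 0}\cdot\Omega_A$ is a closed pointed convex cone spanning $A$, and a linear functional $u_A\in A^*$ which is strictly positive on $A_+\setminus\{0\}$ and satisfies, for $w\in A_+$, $u_A(w)=1\Leftrightarrow w\in\Omega_A$. An effect is an $e\in A^*$ with $0\le e\le u_A$ on $A_+$. Let there be given moreover a set of allowed effects which is convex, closed and spans $A^*$, which contains $u_A-e$ whenever it contains $e$, and which contains $e+f$ whenever it contains $e,f$ and $e+f\le u_A$; and a group $\mathcal G_A$ of reversible transformations, i.e. of linear bijections $T$ of $A$ such that $T$ and $T^{-1}$ map $A_+$ into $A_+$ and do not increase $u_A$ on $A_+$, and such that $e\circ T$ is allowed for every allowed effect $e$. States $w_1,\dots,w_n\in\Omega_A$ are \emph{perfectly distinguishable} if there are allowed effects $e_1,\dots,e_n$ with $\sum_j e_j\le u_A$ and $e_j(w_k)=\delta_{jk}$. A state is \emph{pure} if it is an extreme point of $\Omega_A$. A \emph{classical decomposition} of a state $w$ is a representation $w=\sum_{j=1}^n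 q_jv_j$ with a probability distribution $(q_j)$ and perfectly distinguishable pure states $v_1,\dots,v_n$. Assume \begin{itemize} \item (Postulate 1, classical decomposability) every state $w\in\Omega_A$ has a classical decomposition; \item (Postulate 2, strong symmetry) for every $n$, if $w_1,\dots,w_n$ and $v_1,\dots,v_n$ are both perfectly distinguishable pure states, then there is $T\in\mathcal G_A$ with $Tw_j=v_j$ for all $j$. \end{itemize} Then the entropy $S(w):=-\sum_j q_j\ln q_j$ (with $0\ln 0:=0$), where $w=\sum_j q_jv_j$ is any classical decomposition of $w$, is well defined, i.e. it does not depend on the classical decomposition. Moreover, if $(p_1,\dots,p_n)$ is a probability distribution and $w_1,\dots,w_n\in\Omega_A$ are perfectly distinguishable states, possibly mixed, then for $w=\sum_{j=1}^n p_jw_j$ $$S(w)=\sum_{j=1}^n p_j\,S(w_j)-\sum_{j=1}^n p_j\ln p_j .$$ -/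

import Mathlib

/-!
# Generalized probabilistic theories: state spaces, frames, the two postulates, and the entropy

The ambient space `A` is a finite-dimensional real vector space.  The norm on `A` only serves to
provide the (unique) vector space topology; nothing below depends on which norm is chosen.  In
particular every linear functional is continuous, so the dual space is written `A →L[ℝ] ℝ`.
-/

namespace GPT

/-- The set `ℝ_{≥ 0} · Ω`. -/
def coneOver {A : Type*} [AddCommGroup A] [Module ℝ A] (Ω : Set A) : Set A :=
  {x | ∃ r : ℝ, 0 ≤ r ∧ ∃ w ∈ Ω, x = r • w}

/-- A (pointed, convex) cone: a nonempty set `K` with `K + K ⊆ K`, `p K ⊆ K` for all `p ≥ 0`, and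
`K ∩ (-K) = {0}`. -/
structure IsCone {A : Type*} [AddCommGroup A] [Module ℝ A] (K : Set A) : Prop where
  nonempty : K.Nonempty
  add_mem : ∀ x ∈ K, ∀ y ∈ K, x + y ∈ K
  smul_mem : ∀ p : ℝ, 0 ≤ p → ∀ x ∈ K, p • x ∈ K
  eq_zero : ∀ x ∈ K, -x ∈ K → x = 0

/-- An abstract state space `(A, Ω_A, u_A)`. -/
structure AbstractStateSpace (A : Type*) [NormedAddCommGroup A] [NormedSpace ℝ A] where
  /-- The set `Ω_A` of normalized states. -/
  states : Set A
  /-- The order unit `u_A`, giving the normalization. -/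
  unit : A →L[ℝ] ℝ
  convex_states : Convex ℝ states
  isCompact_states : IsCompact states
  isCone_cone : IsCone (coneOver states)
  isClosed_cone : IsClosed (coneOver states)
  span_cone : Submodule.span ℝ (coneOver states) = ⊤
  unit_pos : ∀ w ∈ coneOver states, w ≠ 0 → 0 < unit w
  unit_eq_one_iff : ∀ w ∈ coneOver states, unit w = 1 ↔ w ∈ states

namespace AbstractStateSpace

variable {A : Type*} [NormedAddCommGroup A] [NormedSpace ℝ A]

/-- The cone `A_+` of unnormalized states. -/
def cone (S : AbstractStateSpace A) : Set A := coneOver S.states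

/-- An effect is a linear functional `e` with `0 ≤ e ≤ u_A` on the cone of unnormalized states. -/
def IsEffect (S : AbstractStateSpace A) (e : A →L[ℝ] ℝ) : Prop :=
  ∀ w ∈ S.cone, 0 ≤ e w ∧ e w ≤ S.unit w

/-- A transformation is a positive linear map that does not increase the normalization. -/
def IsTransformation (S : AbstractStateSpace A) (T : A →L[ℝ] A) : Prop :=
  (∀ w ∈ S.cone, T w ∈ S.cone) ∧ ∀ w ∈ S.cone, S.unit (T w) ≤ S.unit w

end AbstractStateSpace

/-- A dynamical abstract state space: an abstract state space, together with the set of physically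
allowed effects and the group of physically allowed reversible transformations. -/
structure DynamicalStateSpace (A : Type*) [NormedAddCommGroup A] [NormedSpace ℝ A] extends
    AbstractStateSpace A where
  /-- The physically allowed effects. -/
  allowed : Set (A →L[ℝ] ℝ)
  /-- The group `𝒢_A` of reversible transformations; its elements and their inverses are
  transformations and are physically allowed. -/
  reversible : Subgroup (A ≃L[ℝ] A)
  isEffect_of_allowed : ∀ e ∈ allowed, toAbstractStateSpace.IsEffect e
  convex_allowed : Convex ℝ allowed
  isClosed_allowed : IsClosed allowed
  /-- The set of allowed effects has full dimension. -/
  span_allowed : Submodule.span ℝ allowed = ⊤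
  /-- The counter-event of an allowed effect is allowed. -/
  compl_allowed : ∀ e ∈ allowed, unit - e ∈ allowed
  /-- A coarse-graining `e + f` of two allowed effects with `e + f ≤ u_A` is allowed. -/
  add_allowed : ∀ e ∈ allowed, ∀ f ∈ allowed,
    (∀ w ∈ states, e w + f w ≤ unit w) → e + f ∈ allowed
  isTransformation_of_reversible :
    ∀ T ∈ reversible, toAbstractStateSpace.IsTransformation (T : A →L[ℝ] A)
  /-- An allowed transformation followed by an allowed effect is an allowed effect. -/
  comp_allowed : ∀ T ∈ reversible, ∀ e ∈ allowed, e.comp (T : A →L[ℝ] A) ∈ allowed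

namespace DynamicalStateSpace

variable {A : Type*} [NormedAddCommGroup A] [NormedSpace ℝ A]

/-- The states `w_1, …, w_n` are perfectly distinguishable: there are allowed effects `e_1, …, e_n`
with `∑ e_j ≤ u_A` and `e_j (w_k) = δ_{jk}`.  (Allowed effects with `∑ e_j ≤ u_A` are taken to be
part of a common allowed measurement.)  The states may be mixed. -/
def PerfectlyDistinguishable (S : DynamicalStateSpace A) {n : ℕ} (w : Fin n → A) : Prop :=
  (∀ j, w j ∈ S.states) ∧
    ∃ e : Fin n → (A →L[ℝ] ℝ), (∀ j, e j ∈ S.allowed) ∧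
      (∀ x ∈ S.states, ∑ j, e j x ≤ S.unit x) ∧
      ∀ j k, e j (w k) = if j = k then 1 else 0

/-- The pure states are the extreme points of the set of normalized states. -/
def IsPure (S : DynamicalStateSpace A) (w : A) : Prop := w ∈ S.states.extremePoints ℝ

/-- An `n`-frame: `n` perfectly distinguishable pure states. -/
def IsFrame (S : DynamicalStateSpace A) {n : ℕ} (w : Fin n → A) : Prop :=
  (∀ j, S.IsPure (w j)) ∧ S.PerfectlyDistinguishable w

/-- `p_1, …, p_n` is a probability distribution. -/
def _root_.GPT.IsProbDist {n : ℕ} (p : Fin n → ℝ) : Prop := (∀ j, 0 ≤ p j) ∧ ∑ j, p j = 1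

/-- `x = ∑ p_j w_j` is a classical decomposition of `x`: `p` is a probability distribution and the
`w_j` are perfectly distinguishable pure states. -/
def IsClassicalDecomposition (S : DynamicalStateSpace A) (x : A) {n : ℕ} (p : Fin n → ℝ)
    (w : Fin n → A) : Prop :=
  IsProbDist p ∧ S.IsFrame w ∧ x = ∑ j, p j • w j

/-- Postulate 1 (classical decomposability): every state has a classical decomposition. -/
def ClassicalDecomposability (S : DynamicalStateSpace A) : Prop :=
  ∀ x ∈ S.states, ∃ (n : ℕ) (p : Fin n → ℝ) (w : Fin n → A), S.IsClassicalDecomposition x p w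

/-- Postulate 2 (strong symmetry): any two frames of the same size are related by a reversible
transformation. -/
def StrongSymmetry (S : DynamicalStateSpace A) : Prop :=
  ∀ (n : ℕ) (w v : Fin n → A), S.IsFrame w → S.IsFrame v →
    ∃ T ∈ S.reversible, ∀ j, T (w j) = v j

/-- The quantity `-∑ p_j ln p_j`, with `0 ln 0 = 0`. -/
noncomputable def _root_.GPT.shannon {n : ℕ} (p : Fin n → ℝ) : ℝ := -∑ j, p j * Real.log (p j)

/-- `s` is the value `-∑ p_j ln p_j` obtained from some classical decomposition of `x`. -/
def IsEntropyValue (S : DynamicalStateSpace A) (x : A) (s : ℝ) : Prop :=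
  ∃ (n : ℕ) (p : Fin n → ℝ) (w : Fin n → A), S.IsClassicalDecomposition x p w ∧ s = shannon p

open Classical in
/-- The entropy `S(x) = -∑ p_j ln p_j` (per system, with `k_B = 1`), where `x = ∑ p_j w_j` is a
classical decomposition.  That the value is the same for all classical decompositions is not built
into the definition. -/
noncomputable def entropy (S : DynamicalStateSpace A) (x : A) : ℝ :=
  if h : ∃ s, S.IsEntropyValue x s then h.choose else 0

end DynamicalStateSpace

end GPT

/-!
Classical decomposability and strong symmetry turn the state space into a Euclidean space with a
spectral theorem, much like the Hermitian matrices with the trace form, and the entropy is then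
treated as in quantum theory.

The reversible transformations form a bounded group, so they fix a state `μ` and an inner product
`b` (`exists_fixed_point`).  Permuting the members of a frame that decomposes `μ` shows that all its
weights are equal (`exists_hasCapacity`); hence all frames of this size `n` have the same sum
`c = n μ`, and by strong symmetry every frame extends to one of size `n`.  Strong symmetry also makes
`b` constant on pure states and constant on distinguishable pairs of them, so a combination `B` of
`b` and `u ⊗ u` makes every frame orthonormal (`exists_isFrameForm`).  Every vector is diagonal in a
frame of size `n` (`exists_spectral`), which makes `B` positive definite.

The allowed effects are not assumed to contain all effects, but they contain `B w` for each pure `w`: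
an allowed effect that singles out `w` in a frame of size `n` is represented by a vector which, by
the equality case of the Cauchy–Schwarz inequality, is `w` (`exists_allowed_eq`).  Hence `B` is
nonnegative on pairs of a pure state and a state.  For frames `w`, `v` of size `n` the matrix
`B (w j) (v k)` is doubly stochastic, and the weights of two classical decompositions of one state
are images of each other under such matrices; as `-t ln t` is concave, they have equal entropy
(`shannon_le`).

If effects `e j` distinguish the mixed states `w j`, then each `w j` is a mixture of a frame whose
effects sum to at most `e j` (`exists_frame_of_certain`).  The union of these frames is a frame, and
the formula for the entropy of the mixture follows from the product rule for `-t ln t`.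
-/

namespace GPT

/-! ### A fixed point theorem for bounded groups of linear maps -/

/-- A group of uniformly bounded linear maps of a finite-dimensional space which preserves a
nonempty compact convex set has a fixed point in it: `x ↦ sup_T |T x|²`, with a Euclidean norm
`|·|`, is invariant and strictly convex, so its minimizer is unique, hence fixed. -/
theorem exists_fixed_point {V : Type*} [NormedAddCommGroup V] [NormedSpace ℝ V]
    [FiniteDimensional ℝ V] (𝒯 : Set (V →L[ℝ] V))
    (hcomp : ∀ R ∈ 𝒯, ∀ T ∈ 𝒯, R.comp T ∈ 𝒯)
    (hleft : ∀ T ∈ 𝒯, ∃ R ∈ 𝒯, ∀ x, R (T x) = x)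
    {C : ℝ} (hC0 : 0 ≤ C) (hC : ∀ T ∈ 𝒯, ∀ x, ‖T x‖ ≤ C * ‖x‖)
    {K : Set V} (hK : IsCompact K) (hconv : Convex ℝ K) (hne : K.Nonempty)
    (hmap : ∀ T ∈ 𝒯, ∀ x ∈ K, T x ∈ K) :
    ∃ x ∈ K, ∀ T ∈ 𝒯, T x = x := by
  obtain ⟨x₀, hx₀⟩ := hne
  rcases 𝒯.eq_empty_or_nonempty with h𝒯 | ⟨T₀, hT₀⟩
  · exact ⟨x₀, hx₀, by simp [h𝒯]⟩
  have : Nonempty 𝒯 := ⟨⟨T₀, hT₀⟩⟩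
  let φ : V ≃L[ℝ] _ := toEuclidean (E := V)
  let F : V → ℝ := fun x => ⨆ T : 𝒯, ‖φ (T.1 x)‖ ^ 2
  have hbdd : ∀ x, BddAbove (Set.range fun T : 𝒯 => ‖φ (T.1 x)‖ ^ 2) := by
    intro x
    refine ⟨(‖φ.toContinuousLinearMap‖ * (C * ‖x‖)) ^ 2, ?_⟩
    rintro _ ⟨T, rfl⟩
    have h1 : ‖φ (T.1 x)‖ ≤ ‖φ.toContinuousLinearMap‖ * ‖T.1 x‖ :=
      φ.toContinuousLinearMap.le_opNorm _
    have h2 : ‖T.1 x‖ ≤ C * ‖x‖ := hC _ T.2 x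
    dsimp only
    gcongr
    exact h1.trans (by gcongr)
  have hlsc : LowerSemicontinuous F :=
    lowerSemicontinuous_ciSup hbdd fun T => Continuous.lowerSemicontinuous (by fun_prop)
  obtain ⟨x, hxK, hmin⟩ := (hlsc.lowerSemicontinuousOn K).exists_isMinOn ⟨x₀, hx₀⟩ hK
  refine ⟨x, hxK, fun R hR => ?_⟩
  by_contra hne
  set z := x - R x with hz
  have hz0 : 0 < ‖z‖ := norm_pos_iff.2 (sub_ne_zero.2 (Ne.symm hne))
  -- the vectors `T z` stay away from `0`, because the inverses of the maps `T` are bounded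
  obtain ⟨δ, hδ, hδT⟩ : ∃ δ : ℝ, 0 < δ ∧ ∀ T ∈ 𝒯, δ ≤ ‖φ (T z)‖ ^ 2 := by
    set D := C * ‖φ.symm.toContinuousLinearMap‖ with hD
    have hDT : ∀ T ∈ 𝒯, ‖z‖ ≤ D * ‖φ (T z)‖ := by
      intro T hT
      obtain ⟨T', hT', hTT'⟩ := hleft T hT
      calc ‖z‖ = ‖T' (T z)‖ := by rw [hTT']
        _ ≤ C * ‖T z‖ := hC _ hT' _
        _ ≤ C * (‖φ.symm.toContinuousLinearMap‖ * ‖φ (T z)‖) := by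
          gcongr
          simpa using φ.symm.toContinuousLinearMap.le_opNorm (φ (T z))
        _ = D * ‖φ (T z)‖ := by rw [hD]; ring
    have hD0 : 0 < D := by
      have h := hDT T₀ hT₀
      by_contra hD0
      nlinarith [norm_nonneg (φ (T₀ z))]
    refine ⟨(‖z‖ / D) ^ 2, by positivity, fun T hT => ?_⟩
    gcongr
    rw [div_le_iff₀ hD0, mul_comm]
    exact hDT T hT
  have hmid : (1 / 2 : ℝ) • x + (1 / 2 : ℝ) • R x ∈ K :=
    hconv hxK (hmap R hR x hxK) (by norm_num) (by norm_num) (by norm_num)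
  have hle : F ((1 / 2 : ℝ) • x + (1 / 2 : ℝ) • R x) ≤ F x - δ / 4 := by
    refine ciSup_le fun T => ?_
    have h1 : ‖φ (T.1 x)‖ ^ 2 ≤ F x := le_ciSup (hbdd x) T
    have h2 : ‖φ (T.1 (R x))‖ ^ 2 ≤ F x :=
      le_ciSup (hbdd x) ⟨T.1.comp R, hcomp _ T.2 _ hR⟩
    have h3 := hδT T.1 T.2
    have h4 := parallelogram_law_with_norm ℝ (φ (T.1 x)) (φ (T.1 (R x)))
    have h5 : φ (T.1 ((1 / 2 : ℝ) • x + (1 / 2 : ℝ) • R x))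
        = (1 / 2 : ℝ) • (φ (T.1 x) + φ (T.1 (R x))) := by
      simp [map_add, map_smul]
    have h6 : φ (T.1 z) = φ (T.1 x) - φ (T.1 (R x)) := by simp [hz]
    rw [h6] at h3
    rw [h5, norm_smul, mul_pow]
    norm_num
    nlinarith
  have := hmin hmid
  have h' : F x ≤ F ((1 / 2 : ℝ) • x + (1 / 2 : ℝ) • R x) := this
  linarith

namespace DynamicalStateSpace

variable {A : Type*} [NormedAddCommGroup A] [NormedSpace ℝ A]

/-! ### States, effects and reversible transformations -/

theorem mem_cone_of_mem_states (S : DynamicalStateSpace A) {w : A} (hw : w ∈ S.states) :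
    w ∈ S.cone := ⟨1, zero_le_one, w, hw, (one_smul ℝ w).symm⟩

theorem unit_of_mem_states (S : DynamicalStateSpace A) {w : A} (hw : w ∈ S.states) :
    S.unit w = 1 :=
  (S.unit_eq_one_iff w (S.mem_cone_of_mem_states hw)).2 hw

theorem states_nonempty (S : DynamicalStateSpace A) : S.states.Nonempty := by
  obtain ⟨_, _, _, w, hw, _⟩ := S.isCone_cone.nonempty
  exact ⟨w, hw⟩

theorem span_states (S : DynamicalStateSpace A) : Submodule.span ℝ S.states = ⊤ := by
  rw [eq_top_iff, ← S.span_cone, Submodule.span_le]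
  rintro _ ⟨r, _, w, hw, rfl⟩
  exact Submodule.smul_mem _ _ (Submodule.subset_span hw)

/-- Linear maps that agree on all states are equal. -/
theorem eq_of_eqOn_states (S : DynamicalStateSpace A) {M : Type*} [AddCommGroup M] [Module ℝ M]
    {f g : A →ₗ[ℝ] M} (h : ∀ w ∈ S.states, f w = g w) : f = g :=
  LinearMap.ext_on S.span_states h

theorem allowed_nonneg (S : DynamicalStateSpace A) {e : A →L[ℝ] ℝ} (he : e ∈ S.allowed)
    {w : A} (hw : w ∈ S.states) : 0 ≤ e w :=
  (S.isEffect_of_allowed e he w (S.mem_cone_of_mem_states hw)).1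

theorem allowed_le_one (S : DynamicalStateSpace A) {e : A →L[ℝ] ℝ} (he : e ∈ S.allowed)
    {w : A} (hw : w ∈ S.states) : e w ≤ 1 := by
  have h := (S.isEffect_of_allowed e he w (S.mem_cone_of_mem_states hw)).2
  rwa [S.unit_of_mem_states hw] at h

theorem unit_mem_allowed (S : DynamicalStateSpace A) : S.unit ∈ S.allowed := by
  obtain ⟨w, hw⟩ := S.states_nonempty
  have hne : S.allowed.Nonempty := by
    rw [Set.nonempty_iff_ne_empty]
    intro h
    have h0 : S.unit ∈ Submodule.span ℝ S.allowed := by rw [S.span_allowed]; trivial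
    rw [h, Submodule.span_empty, Submodule.mem_bot] at h0
    simpa [h0] using S.unit_of_mem_states hw
  obtain ⟨e, he⟩ := hne
  have h := S.add_allowed e he _ (S.compl_allowed e he) fun w _ => by simp
  simpa using h

theorem reversible_mem_states (S : DynamicalStateSpace A) {T : A ≃L[ℝ] A}
    (hT : T ∈ S.reversible) {w : A} (hw : w ∈ S.states) : T w ∈ S.states := by
  have hwc := S.mem_cone_of_mem_states hw
  have h1 := S.isTransformation_of_reversible T hT
  have h2 := S.isTransformation_of_reversible T⁻¹ (inv_mem hT)
  have hTw : T w ∈ S.cone := h1.1 w hwc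
  refine (S.unit_eq_one_iff _ hTw).1 (le_antisymm ?_ ?_)
  · exact (h1.2 w hwc).trans_eq (S.unit_of_mem_states hw)
  · have h3 := h2.2 _ hTw
    have h4 : (T⁻¹ : A ≃L[ℝ] A) (T w) = w := T.symm_apply_apply w
    rw [ContinuousLinearEquiv.coe_coe, h4, S.unit_of_mem_states hw] at h3
    exact h3

theorem unit_reversible (S : DynamicalStateSpace A) {T : A ≃L[ℝ] A}
    (hT : T ∈ S.reversible) (x : A) : S.unit (T x) = S.unit x := by
  have h : (S.unit.comp (T : A →L[ℝ] A) : A →ₗ[ℝ] ℝ) = (S.unit : A →ₗ[ℝ] ℝ) :=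
    S.eq_of_eqOn_states fun w hw => by
      simp [S.unit_of_mem_states hw, S.unit_of_mem_states (S.reversible_mem_states hT hw)]
  exact LinearMap.congr_fun h x

theorem reversible_isPure (S : DynamicalStateSpace A) {T : A ≃L[ℝ] A}
    (hT : T ∈ S.reversible) {w : A} (hw : S.IsPure w) : S.IsPure (T w) := by
  refine ⟨S.reversible_mem_states hT hw.1, fun x hx y hy hxy => ?_⟩
  have hx' : T.symm x ∈ S.states := S.reversible_mem_states (inv_mem hT) hx
  have hy' : T.symm y ∈ S.states := S.reversible_mem_states (inv_mem hT) hy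
  have h : w ∈ openSegment ℝ (T.symm x) (T.symm y) := by
    obtain ⟨a, b, ha, hb, hab, h⟩ := hxy
    refine ⟨a, b, ha, hb, hab, ?_⟩
    rw [← T.symm_apply_apply w, ← h, map_add, map_smul, map_smul]
  rw [← hw.2 hx' hy' h, T.apply_symm_apply]

/-! ### Frames -/

/-- Reversible transformations map frames to frames. -/
theorem IsFrame.map {S : DynamicalStateSpace A} {n : ℕ} {w : Fin n → A} (hw : S.IsFrame w)
    {T : A ≃L[ℝ] A} (hT : T ∈ S.reversible) : S.IsFrame fun j => T (w j) := by
  obtain ⟨hp, hs, e, he, hsum, hδ⟩ := hw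
  refine ⟨fun j => S.reversible_isPure hT (hp j), fun j => S.reversible_mem_states hT (hs j),
    fun j => (e j).comp ((T⁻¹ : A ≃L[ℝ] A) : A →L[ℝ] A),
    fun j => S.comp_allowed _ (inv_mem hT) _ (he j), fun x hx => ?_, fun j k => ?_⟩
  · have h := hsum _ (S.reversible_mem_states (inv_mem hT) hx)
    rwa [S.unit_reversible (inv_mem hT)] at h
  · have h : (T⁻¹ : A ≃L[ℝ] A) (T (w k)) = w k := T.symm_apply_apply _
    simp [h, hδ]

/-- Sub-families of frames are frames. -/
theorem IsFrame.comp {S : DynamicalStateSpace A} {n m : ℕ} {w : Fin n → A} (hw : S.IsFrame w)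
    {f : Fin m → Fin n} (hf : Function.Injective f) : S.IsFrame (w ∘ f) := by
  obtain ⟨hp, hs, e, he, hsum, hδ⟩ := hw
  refine ⟨fun j => hp _, fun j => hs _, e ∘ f, fun j => he _, fun x hx => ?_, fun j k => ?_⟩
  · refine le_trans ?_ (hsum x hx)
    rw [show ∑ j, (e ∘ f) j x = ∑ i ∈ Finset.univ.image f, e i x from
      (Finset.sum_image (f := fun i => e i x) hf.injOn).symm]
    exact Finset.sum_le_sum_of_subset_of_nonneg (Finset.subset_univ _)
      fun j _ _ => S.allowed_nonneg (he j) hx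
  · simp [hδ, hf.eq_iff]

theorem isFrame_of_isPure (S : DynamicalStateSpace A) {w : A} (hw : S.IsPure w) :
    S.IsFrame fun _ : Fin 1 => w :=
  ⟨fun _ => hw, fun _ => hw.1, fun _ => S.unit, fun _ => S.unit_mem_allowed,
    fun x _ => by simp, fun j k => by simp [S.unit_of_mem_states hw.1, Subsingleton.elim j k]⟩

/-- The reversible transformations are uniformly bounded, because they preserve the states, which
are bounded and span the space. -/
theorem exists_bound_reversible [FiniteDimensional ℝ A] (S : DynamicalStateSpace A) :
    ∃ C : ℝ, 0 ≤ C ∧ ∀ T ∈ S.reversible, ∀ x, ‖T x‖ ≤ C * ‖x‖ := by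
  have : CompleteSpace A := FiniteDimensional.complete ℝ A
  obtain ⟨D, hD⟩ := S.isCompact_states.isBounded.exists_norm_le
  obtain ⟨C, hC⟩ := banach_steinhaus (g := fun T : S.reversible => ((T : A ≃L[ℝ] A) : A →L[ℝ] A))
    (fun x => by
      have hx : x ∈ Submodule.span ℝ S.states := by rw [S.span_states]; trivial
      induction hx using Submodule.span_induction with
      | mem w hw => exact ⟨D, fun T => hD _ (S.reversible_mem_states T.2 hw)⟩
      | zero => exact ⟨0, fun T => by simp⟩
      | add x y _ _ hx hy =>
        obtain ⟨a, ha⟩ := hx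
        obtain ⟨b, hb⟩ := hy
        refine ⟨a + b, fun T => ?_⟩
        rw [map_add]
        exact (norm_add_le _ _).trans (add_le_add (ha T) (hb T))
      | smul r x _ hx =>
        obtain ⟨a, ha⟩ := hx
        refine ⟨‖r‖ * a, fun T => ?_⟩
        rw [map_smul, norm_smul]
        exact mul_le_mul_of_nonneg_left (ha T) (norm_nonneg _))
  exact ⟨C, (norm_nonneg _).trans (hC 1),
    fun T hT x => (T : A →L[ℝ] A).le_of_opNorm_le (hC ⟨T, hT⟩) x⟩

theorem exists_invariant_state [FiniteDimensional ℝ A] (S : DynamicalStateSpace A) :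
    ∃ μ ∈ S.states, ∀ T ∈ S.reversible, T μ = μ := by
  obtain ⟨C, hC0, hC⟩ := S.exists_bound_reversible
  obtain ⟨μ, hμ, h⟩ := exists_fixed_point
    {R : A →L[ℝ] A | ∃ T ∈ S.reversible, R = (T : A →L[ℝ] A)}
    (by
      rintro _ ⟨T, hT, rfl⟩ _ ⟨T', hT', rfl⟩
      exact ⟨T * T', mul_mem hT hT', rfl⟩)
    (by
      rintro _ ⟨T, hT, rfl⟩
      exact ⟨_, ⟨T⁻¹, inv_mem hT, rfl⟩, T.symm_apply_apply⟩)
    hC0 (by rintro _ ⟨T, hT, rfl⟩; exact hC T hT)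
    S.isCompact_states S.convex_states S.states_nonempty
    (by rintro _ ⟨T, hT, rfl⟩ x hx; exact S.reversible_mem_states hT hx)
  exact ⟨μ, hμ, fun T hT => h _ ⟨T, hT, rfl⟩⟩

/-- `n` is the capacity of the system, with total vector `c`: there are frames of size `n ≥ 1`, and
the members of each of them sum to `c`.  In fact `c = n μ` for the invariant state `μ`. -/
structure HasCapacity (S : DynamicalStateSpace A) (n : ℕ) (c : A) : Prop where
  pos : 0 < n
  exists_frame : ∃ w : Fin n → A, S.IsFrame w
  sum_eq : ∀ w : Fin n → A, S.IsFrame w → ∑ j, w j = c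

/-- The capacity is the size of a frame that decomposes the invariant state `μ`: permuting this frame
shows that all weights are equal, and strong symmetry carries this to every frame of its size. -/
theorem exists_hasCapacity [FiniteDimensional ℝ A] (S : DynamicalStateSpace A)
    (h1 : S.ClassicalDecomposability) (h2 : S.StrongSymmetry) :
    ∃ (n : ℕ) (c : A), S.HasCapacity n c := by
  obtain ⟨μ, hμ, hinv⟩ := S.exists_invariant_state
  obtain ⟨n, p, w, ⟨hp0, hp1⟩, hw, hx⟩ := h1 μ hμ
  have hn : 0 < n := by
    rcases Nat.eq_zero_or_pos n with rfl | h
    · simp at hp1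
    · exact h
  obtain ⟨-, -, e, he, -, hδ⟩ := id hw
  have hval : ∀ k, e k μ = p k := fun k => by simp [hx, hδ]
  have hperm : ∀ j k, p j = p k := by
    intro j k
    obtain ⟨T, hT, hTw⟩ := h2 n w (w ∘ Equiv.swap j k) hw (hw.comp (Equiv.swap j k).injective)
    have h := hval k
    rw [← hinv T hT, hx] at h
    have hi : ∀ i, k = Equiv.swap j k i ↔ i = j := fun i => by
      rw [eq_comm, Equiv.swap_apply_eq_iff, Equiv.swap_apply_right]
    simpa [hTw, hδ, hi] using h
  have hpn : ∀ j, p j = 1 / n := by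
    intro j
    have h : ∑ i : Fin n, p j = 1 := by rw [← hp1]; exact Finset.sum_congr rfl fun i _ => hperm j i
    have : (n : ℝ) ≠ 0 := by positivity
    simp at h
    field_simp
    linarith
  have hsum : ∑ j, w j = (n : ℝ) • μ := by
    have : (n : ℝ) ≠ 0 := by positivity
    simp only [hpn] at hx
    rw [← Finset.smul_sum] at hx
    rw [hx, smul_smul, mul_one_div_cancel this, one_smul]
  refine ⟨n, (n : ℝ) • μ, hn, ⟨w, hw⟩, fun v hv => ?_⟩
  obtain ⟨T, hT, hTw⟩ := h2 n w v hw hv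
  rw [← Finset.sum_congr rfl fun j _ => hTw j, ← map_sum, hsum, map_smul, hinv T hT]

/-- Every frame extends to a frame whose size is the capacity. -/
theorem IsFrame.exists_append {S : DynamicalStateSpace A} (h2 : S.StrongSymmetry) {n : ℕ} {c : A}
    (hc : S.HasCapacity n c) {m : ℕ} {v : Fin m → A} (hv : S.IsFrame v) :
    ∃ (k : ℕ) (v' : Fin k → A), n = m + k ∧ S.IsFrame (Fin.append v v') := by
  obtain ⟨hn, ⟨w, hw⟩, hc⟩ := hc
  have hmn : m ≤ n := by
    -- otherwise two subfamilies of `n + 1` frame members, differing in one member, sum to `c`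
    by_contra h
    push Not at h
    have hf : S.IsFrame (v ∘ Fin.castLE h) := hv.comp (Fin.castLE_injective h)
    have e1 := hc _ (hf.comp (Fin.castSucc_injective n))
    have e2 := hc _ (hf.comp (Fin.succ_injective n))
    have e3 := Fin.sum_univ_succ (v ∘ Fin.castLE h)
    have e4 := Fin.sum_univ_castSucc (v ∘ Fin.castLE h)
    simp only [Function.comp_apply] at e1 e2 e3 e4
    rw [e2] at e3
    rw [e1, e3, add_comm] at e4
    have e5 := add_left_cancel e4
    obtain ⟨-, -, e, -, -, hδ⟩ := hf
    have e6 := hδ 0 0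
    have e7 := hδ 0 (Fin.last n)
    have : (0 : Fin (n + 1)) ≠ Fin.last n := by
      intro h; have := congrArg Fin.val h; simp at this; omega
    simp only [Function.comp_apply, e5] at e6 e7
    rw [e6] at e7
    simp [this] at e7
  obtain ⟨k, rfl⟩ := Nat.exists_eq_add_of_le hmn
  obtain ⟨T, hT, hTw⟩ := h2 m _ v (hw.comp (Fin.castAdd_injective m k)) hv
  refine ⟨k, fun i => T (w (Fin.natAdd m i)), rfl, ?_⟩
  convert hw.map hT using 1
  funext j
  refine Fin.addCases (fun i => ?_) (fun i => ?_) j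
  · simpa using (hTw i).symm
  · simp

/-! ### A bilinear form for which all frames are orthonormal -/

/-- The pullback `b ↦ ((x, y) ↦ b (T x) (T y))` of bilinear forms along `T`. -/
noncomputable def pullbackForm (T : A →L[ℝ] A) :
    (A →L[ℝ] A →L[ℝ] ℝ) →L[ℝ] (A →L[ℝ] A →L[ℝ] ℝ) :=
  ((ContinuousLinearMap.compL ℝ A A (A →L[ℝ] ℝ)).flip T).comp
    (ContinuousLinearMap.compL ℝ A _ _ ((ContinuousLinearMap.compL ℝ A A ℝ).flip T))

theorem pullbackForm_apply (T : A →L[ℝ] A) (b : A →L[ℝ] A →L[ℝ] ℝ) (x y : A) :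
    pullbackForm T b x y = b (T x) (T y) := rfl

theorem norm_pullbackForm_le {T : A →L[ℝ] A} {C : ℝ} (hC0 : 0 ≤ C)
    (hC : ∀ x, ‖T x‖ ≤ C * ‖x‖) (b : A →L[ℝ] A →L[ℝ] ℝ) :
    ‖pullbackForm T b‖ ≤ C * C * ‖b‖ := by
  refine ContinuousLinearMap.opNorm_le_bound₂ _ (by positivity) fun x y => ?_
  rw [pullbackForm_apply]
  calc ‖b (T x) (T y)‖ ≤ ‖b‖ * ‖T x‖ * ‖T y‖ := b.le_opNorm₂ _ _
    _ ≤ ‖b‖ * (C * ‖x‖) * (C * ‖y‖) := by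
      gcongr <;> exact hC _
    _ = C * C * ‖b‖ * ‖x‖ * ‖y‖ := by ring

/-- There is an inner product that is invariant under all reversible transformations. -/
theorem exists_invariant_form [FiniteDimensional ℝ A] (S : DynamicalStateSpace A) :
    ∃ b : A →L[ℝ] A →L[ℝ] ℝ, (∀ x y, b x y = b y x) ∧ (∀ x, x ≠ 0 → 0 < b x x) ∧
      ∀ T ∈ S.reversible, ∀ x y, b (T x) (T y) = b x y := by
  obtain ⟨C, hC0, hCT⟩ := S.exists_bound_reversible
  have hCT' : ∀ T ∈ S.reversible, ∀ x, ‖x‖ ≤ C * ‖T x‖ := fun T hT x => by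
    have h := hCT _ (inv_mem hT) (T x)
    rwa [show (T⁻¹ : A ≃L[ℝ] A) (T x) = x from T.symm_apply_apply x] at h
  let φ := toEuclidean (E := A)
  let Φ := φ.toContinuousLinearMap
  set p := ‖φ.toContinuousLinearMap‖ with hp
  set q := ‖φ.symm.toContinuousLinearMap‖ with hq
  have hφ : ∀ x, ‖φ x‖ ≤ p * ‖x‖ := fun x => φ.toContinuousLinearMap.le_opNorm x
  have hφ' : ∀ x, ‖x‖ ≤ q * ‖φ x‖ := fun x => by
    simpa using φ.symm.toContinuousLinearMap.le_opNorm (φ x)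
  let b₀ : A →L[ℝ] A →L[ℝ] ℝ := (innerSL ℝ).bilinearComp Φ Φ
  have hb₀ : ∀ x y, b₀ x y = inner ℝ (φ x) (φ y) := fun x y => rfl
  -- invariant bounds, satisfied by the Euclidean inner product, that cut out a compact set of forms
  let K : Set (A →L[ℝ] A →L[ℝ] ℝ) :=
    {b | (∀ x y, b x y = b y x) ∧
      (∀ T ∈ S.reversible, ∀ x y, ‖b (T x) (T y)‖ ≤ (p * C) ^ 2 * ‖x‖ * ‖y‖) ∧
      ∀ T ∈ S.reversible, ∀ x, ‖x‖ ^ 2 ≤ (C * q) ^ 2 * b (T x) (T x)}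
  have hb₀K : b₀ ∈ K := by
    refine ⟨fun x y => ?_, fun T hT x y => ?_, fun T hT x => ?_⟩
    · rw [hb₀, hb₀, real_inner_comm]
    · rw [hb₀]
      calc ‖inner ℝ (φ (T x)) (φ (T y))‖ ≤ ‖φ (T x)‖ * ‖φ (T y)‖ := norm_inner_le_norm _ _
        _ ≤ (p * (C * ‖x‖)) * (p * (C * ‖y‖)) := by
          gcongr
          · exact (hφ _).trans (by gcongr; exact hCT T hT x)
          · exact (hφ _).trans (by gcongr; exact hCT T hT y)
        _ = (p * C) ^ 2 * ‖x‖ * ‖y‖ := by ring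
    · rw [hb₀, real_inner_self_eq_norm_sq, ← mul_pow]
      gcongr
      calc ‖x‖ ≤ C * ‖T x‖ := hCT' T hT x
        _ ≤ C * (q * ‖φ (T x)‖) := by gcongr; exact hφ' _
        _ = C * q * ‖φ (T x)‖ := by ring
  have hK : IsCompact K := by
    have : ProperSpace (A →L[ℝ] A →L[ℝ] ℝ) := FiniteDimensional.proper_real (A →L[ℝ] A →L[ℝ] ℝ)
    refine Metric.isCompact_of_isClosed_isBounded (α := A →L[ℝ] A →L[ℝ] ℝ) ?_ ?_
    · simp only [K, Set.ofPred_and, Set.ofPred_forall]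
      refine IsClosed.inter ?_ (IsClosed.inter ?_ ?_)
      · exact isClosed_iInter fun x => isClosed_iInter fun y =>
          isClosed_eq (by fun_prop) (by fun_prop)
      · exact isClosed_iInter fun T => isClosed_iInter fun _ => isClosed_iInter fun x =>
          isClosed_iInter fun y => isClosed_le (by fun_prop) (by fun_prop)
      · exact isClosed_iInter fun T => isClosed_iInter fun _ => isClosed_iInter fun x =>
          isClosed_le (by fun_prop) (by fun_prop)
    · refine isBounded_iff_forall_norm_le.2 ⟨(p * C) ^ 2, fun b hb => ?_⟩
      exact ContinuousLinearMap.opNorm_le_bound₂ _ (by positivity)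
        fun x y => hb.2.1 1 (one_mem _) x y
  have hKc : Convex ℝ K := by
    rintro b ⟨hb1, hb2, hb3⟩ b' ⟨hb1', hb2', hb3'⟩ s t hs ht hst
    refine ⟨fun x y => ?_, fun T hT x y => ?_, fun T hT x => ?_⟩
    · simp [hb1 x y, hb1' x y]
    · have h := hb2 T hT x y
      have h' := hb2' T hT x y
      calc ‖(s • b + t • b') (T x) (T y)‖ = ‖s * b (T x) (T y) + t * b' (T x) (T y)‖ := by simp
        _ ≤ s * ‖b (T x) (T y)‖ + t * ‖b' (T x) (T y)‖ := by
          refine (norm_add_le _ _).trans_eq ?_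
          rw [norm_mul, norm_mul, Real.norm_of_nonneg hs, Real.norm_of_nonneg ht]
        _ ≤ s * ((p * C) ^ 2 * ‖x‖ * ‖y‖) + t * ((p * C) ^ 2 * ‖x‖ * ‖y‖) := by gcongr
        _ = (p * C) ^ 2 * ‖x‖ * ‖y‖ := by rw [← add_mul, hst, one_mul]
    · have h := mul_le_mul_of_nonneg_left (hb3 T hT x) hs
      have h' := mul_le_mul_of_nonneg_left (hb3' T hT x) ht
      calc ‖x‖ ^ 2 = s * ‖x‖ ^ 2 + t * ‖x‖ ^ 2 := by rw [← add_mul, hst, one_mul]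
        _ ≤ _ := add_le_add h h'
        _ = _ := by simp; ring
  obtain ⟨b, hbK, hb⟩ := exists_fixed_point
    {R | ∃ T ∈ S.reversible, R = pullbackForm (T : A →L[ℝ] A)}
    (by
      rintro _ ⟨T, hT, rfl⟩ _ ⟨T', hT', rfl⟩
      exact ⟨T' * T, mul_mem hT' hT, rfl⟩)
    (by
      rintro _ ⟨T, hT, rfl⟩
      refine ⟨_, ⟨T⁻¹, inv_mem hT, rfl⟩, fun b => ?_⟩
      ext x y
      exact congrArg₂ (fun x y => b x y) (T.apply_symm_apply x) (T.apply_symm_apply y))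
    (mul_nonneg hC0 hC0)
    (by
      rintro _ ⟨T, hT, rfl⟩ b
      exact norm_pullbackForm_le hC0 (hCT T hT) b)
    hK hKc ⟨b₀, hb₀K⟩
    (by
      rintro _ ⟨T, hT, rfl⟩ b hb
      exact ⟨fun x y => hb.1 _ _, fun T' hT' x y => hb.2.1 (T * T') (mul_mem hT hT') x y,
        fun T' hT' x => hb.2.2 (T * T') (mul_mem hT hT') x⟩)
  refine ⟨b, hbK.1, fun x hx => ?_, fun T hT x y => ?_⟩
  · have h := hbK.2.2 1 (one_mem _) x
    have h0 : 0 < ‖x‖ ^ 2 := by have := norm_pos_iff.2 hx; positivity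
    exact pos_of_mul_pos_right (h0.trans_le h) (by positivity)
  · exact congrArg (fun b : A →L[ℝ] A →L[ℝ] ℝ => b x y) (hb _ ⟨T, hT, rfl⟩)

/-- A symmetric bilinear form for which every frame is orthonormal. -/
structure IsFrameForm (S : DynamicalStateSpace A) (B : A →ₗ[ℝ] A →ₗ[ℝ] ℝ) : Prop where
  symm : ∀ x y, B x y = B y x
  frame : ∀ {m : ℕ} {w : Fin m → A}, S.IsFrame w → ∀ j k, B (w j) (w k) = if j = k then 1 else 0

/-- For an invariant inner product `b`, by strong symmetry, `b w w = γ` for every pure `w` and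
`b v w = β < γ` for all distinguishable pairs; `(b - β u ⊗ u) / (γ - β)` is a frame form. -/
theorem exists_isFrameForm [FiniteDimensional ℝ A] (S : DynamicalStateSpace A)
    (h2 : S.StrongSymmetry) {n : ℕ} {c : A} (hc : S.HasCapacity n c) :
    ∃ B, S.IsFrameForm B := by
  obtain ⟨b, hsymm, hpos, hinv⟩ := S.exists_invariant_form
  have hne : ∀ {w}, w ∈ S.states → w ≠ 0 := fun {w} hw h => by
    simpa [h] using S.unit_of_mem_states hw
  obtain ⟨w₀, hw₀⟩ := hc.exists_frame
  have hself : ∀ v w, S.IsPure v → S.IsPure w → b v v = b w w := by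
    intro v w hv hw
    obtain ⟨T, hT, h⟩ := h2 1 _ _ (S.isFrame_of_isPure hv) (S.isFrame_of_isPure hw)
    rw [← h 0, hinv T hT]
  have hpair : ∀ {m : ℕ} {w : Fin m → A}, S.IsFrame w → ∀ j k, j ≠ k →
      S.IsFrame (w ∘ ![j, k]) := by
    intro m w hw j k hjk
    refine hw.comp fun a a' h => ?_
    fin_cases a <;> fin_cases a' <;> simp_all
  obtain ⟨β, γ, hβγ, hβ, hγ⟩ : ∃ β γ : ℝ, β < γ ∧
      (∀ {m : ℕ} {w : Fin m → A}, S.IsFrame w → ∀ j k, j ≠ k → b (w j) (w k) = β) ∧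
      ∀ w, S.IsPure w → b w w = γ := by
    by_cases h : ∃ v : Fin 2 → A, S.IsFrame v
    · obtain ⟨v, hv⟩ := h
      refine ⟨b (v 0) (v 1), b (v 0) (v 0), ?_, fun {m w} hw j k hjk => ?_,
        fun w hw => hself _ _ hw (hv.1 0)⟩
      · have hv01 : v 0 - v 1 ≠ 0 := by
          intro h
          obtain ⟨e, -, -, hδ⟩ := hv.2.2
          have h0 := hδ 0 0
          have h1 := hδ 0 1
          rw [sub_eq_zero.1 h] at h0
          simp [h0] at h1
        have h := hpos _ hv01
        simp only [map_sub, sub_apply] at h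
        rw [hself _ _ (hv.1 1) (hv.1 0), hsymm (v 1) (v 0)] at h
        linarith
      · obtain ⟨T, hT, h⟩ := h2 2 v _ hv (hpair hw j k hjk)
        have h0 := h 0
        have h1 := h 1
        simp only [Function.comp_apply, Matrix.cons_val_zero, Matrix.cons_val_one] at h0 h1
        rw [← h0, ← h1, hinv T hT]
    · refine ⟨0, b (w₀ ⟨0, hc.pos⟩) (w₀ ⟨0, hc.pos⟩), hpos _ (hne (hw₀.2.1 _)),
        fun hw j k hjk => absurd ⟨_, hpair hw j k hjk⟩ h, fun w hw => hself _ _ hw (hw₀.1 _)⟩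
  have hd : γ - β ≠ 0 := (sub_pos.2 hβγ).ne'
  refine ⟨LinearMap.mk₂ ℝ (fun x y => (b x y - β * S.unit x * S.unit y) / (γ - β))
    (fun x x' y => ?_) (fun r x y => ?_) (fun x y y' => ?_) (fun r x y => ?_), ?_, ?_⟩
  · simp; ring
  · simp; ring
  · simp; ring
  · simp; ring
  · intro x y
    simp only [LinearMap.mk₂_apply]
    rw [hsymm x y]; ring
  · intro m w hw j k
    simp only [LinearMap.mk₂_apply]
    rw [S.unit_of_mem_states (hw.2.1 j), S.unit_of_mem_states (hw.2.1 k)]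
    split_ifs with hjk
    · subst hjk
      rw [hγ _ (hw.1 j), mul_one, mul_one, div_self hd]
    · rw [hβ hw j k hjk]; simp

/-! ### Spectral decompositions and self-duality -/

/-- Extending a frame and padding the weights with zeros, a classical decomposition can be taken to
have the size of the capacity. -/
theorem IsClassicalDecomposition.exists_capacity {S : DynamicalStateSpace A}
    (h2 : S.StrongSymmetry) {n : ℕ} {c : A} (hc : S.HasCapacity n c) {x : A} {m : ℕ}
    {p : Fin m → ℝ} {w : Fin m → A} (h : S.IsClassicalDecomposition x p w) :
    ∃ (q : Fin n → ℝ) (v : Fin n → A), S.IsClassicalDecomposition x q v ∧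
      shannon q = shannon p := by
  obtain ⟨⟨hp0, hp1⟩, hw, rfl⟩ := h
  obtain ⟨k, v', rfl, hv⟩ := hw.exists_append h2 hc
  refine ⟨Fin.append p fun _ => 0, Fin.append w v', ⟨⟨fun j => ?_, ?_⟩, hv, ?_⟩, ?_⟩
  · refine Fin.addCases (fun i => ?_) (fun i => ?_) j
    · simpa using hp0 i
    · simp
  · simpa [Fin.sum_univ_add] using hp1
  · simp [Fin.sum_univ_add]
  · simp [shannon, Fin.sum_univ_add]

theorem sum_mem_cone (S : DynamicalStateSpace A) {n : ℕ} {r : Fin n → ℝ} (hr : ∀ j, 0 ≤ r j)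
    {v : Fin n → A} (hv : ∀ j, v j ∈ S.states) : ∑ j, r j • v j ∈ S.cone := by
  have hadd := S.isCone_cone.add_mem
  refine Finset.sum_induction (p := (· ∈ S.cone)) _ (fun a b ha hb => hadd a ha b hb) ?_
    fun j _ => ⟨r j, hr j, v j, hv j, rfl⟩
  obtain ⟨w, hw⟩ := S.states_nonempty
  exact ⟨0, le_rfl, w, hw, (zero_smul ℝ w).symm⟩

/-- Every vector is a real combination of the members of a frame of maximal size: adding a multiple
of `c`, which is an order unit of the cone, turns it into a multiple of a state. -/
theorem exists_spectral {S : DynamicalStateSpace A} (h1 : S.ClassicalDecomposability)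
    (h2 : S.StrongSymmetry) {n : ℕ} {c : A} (hc : S.HasCapacity n c) (x : A) :
    ∃ (r : Fin n → ℝ) (v : Fin n → A), S.IsFrame v ∧ x = ∑ j, r j • v j := by
  have hdec : ∀ w ∈ S.states, ∃ (r : Fin n → ℝ) (v : Fin n → A),
      S.IsClassicalDecomposition w r v := fun w hw => by
    obtain ⟨m, p, v, h⟩ := h1 w hw
    obtain ⟨q, v', h', -⟩ := h.exists_capacity h2 hc
    exact ⟨q, v', h'⟩
  have hadd := S.isCone_cone.add_mem
  have hsmul := S.isCone_cone.smul_mem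
  have hkey : ∃ R : ℝ, R • c + x ∈ S.cone ∧ R • c - x ∈ S.cone := by
    have hx : x ∈ Submodule.span ℝ S.states := by rw [S.span_states]; trivial
    induction hx using Submodule.span_induction with
    | mem w hw =>
      obtain ⟨r, v, ⟨hr0, hr1⟩, hv, hwr⟩ := hdec w hw
      have hcv : (1 : ℝ) • c = ∑ j, (1 : ℝ) • v j := by simp [hc.sum_eq v hv]
      refine ⟨1, ?_, ?_⟩
      · rw [hcv]
        exact hadd _ (S.sum_mem_cone (fun _ => zero_le_one) hv.2.1) _
          (S.mem_cone_of_mem_states hw)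
      · rw [hcv, hwr, ← Finset.sum_sub_distrib]
        simp only [← sub_smul]
        refine S.sum_mem_cone (fun j => sub_nonneg.2 ?_) hv.2.1
        rw [← hr1]
        exact Finset.single_le_sum (fun i _ => hr0 i) (Finset.mem_univ j)
    | zero =>
      obtain ⟨w, hw⟩ := S.states_nonempty
      have h0 : (0 : A) ∈ S.cone := ⟨0, le_rfl, w, hw, (zero_smul ℝ w).symm⟩
      exact ⟨0, by simpa using h0, by simpa using h0⟩
    | add x y _ _ hx hy =>
      obtain ⟨R, h, h'⟩ := hx
      obtain ⟨Q, k, k'⟩ := hy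
      refine ⟨R + Q, ?_, ?_⟩
      · rw [show (R + Q) • c + (x + y) = (R • c + x) + (Q • c + y) by module]
        exact hadd _ h _ k
      · rw [show (R + Q) • c - (x + y) = (R • c - x) + (Q • c - y) by module]
        exact hadd _ h' _ k'
    | smul s x _ hx =>
      obtain ⟨R, h, h'⟩ := hx
      rcases le_total 0 s with hs | hs
      · refine ⟨s * R, ?_, ?_⟩
        · rw [show (s * R) • c + s • x = s • (R • c + x) by module]
          exact hsmul s hs _ h
        · rw [show (s * R) • c - s • x = s • (R • c - x) by module]
          exact hsmul s hs _ h'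
      · refine ⟨-s * R, ?_, ?_⟩
        · rw [show (-s * R) • c + s • x = (-s) • (R • c - x) by module]
          exact hsmul (-s) (neg_nonneg.2 hs) _ h'
        · rw [show (-s * R) • c - s • x = (-s) • (R • c + x) by module]
          exact hsmul (-s) (neg_nonneg.2 hs) _ h
  obtain ⟨R, ⟨s, hs, w, hw, h⟩, -⟩ := hkey
  obtain ⟨r, v, -, hv, hwr⟩ := hdec w hw
  refine ⟨fun j => s * r j - R, v, hv, ?_⟩
  simp only [sub_smul, Finset.sum_sub_distrib, ← Finset.smul_sum, hc.sum_eq v hv, mul_smul]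
  rw [← hwr, ← h]
  module

theorem sum_equivFin_symm {n : ℕ} (I : Finset (Fin n)) {M : Type*} [AddCommMonoid M]
    (f : Fin n → M) : ∑ k, f (I.equivFin.symm k) = ∑ i ∈ I, f i :=
  (Equiv.sum_comp I.equivFin.symm fun i : I => f i).trans (Finset.sum_coe_sort I f)

namespace IsFrameForm

variable {S : DynamicalStateSpace A} {B : A →ₗ[ℝ] A →ₗ[ℝ] ℝ}

theorem apply_sum (hB : S.IsFrameForm B) {n : ℕ} {v : Fin n → A} (hv : S.IsFrame v)
    (r : Fin n → ℝ) (k : Fin n) : B (v k) (∑ j, r j • v j) = r k := by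
  simp [hB.frame hv]

theorem apply_pure (hB : S.IsFrameForm B) {w : A} (hw : S.IsPure w) : B w w = 1 := by
  simpa using hB.frame (S.isFrame_of_isPure hw) 0 0

theorem apply_self (hB : S.IsFrameForm B) {n : ℕ} {v : Fin n → A} (hv : S.IsFrame v)
    (r : Fin n → ℝ) : B (∑ j, r j • v j) (∑ j, r j • v j) = ∑ j, r j ^ 2 := by
  rw [LinearMap.map_sum₂]
  refine Finset.sum_congr rfl fun k _ => ?_
  rw [map_smul, LinearMap.smul_apply, hB.apply_sum hv, smul_eq_mul, sq]

theorem apply_capacity (hB : S.IsFrameForm B) (h1 : S.ClassicalDecomposability)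
    (h2 : S.StrongSymmetry) {n : ℕ} {c : A} (hc : S.HasCapacity n c) (x : A) :
    B c x = S.unit x := by
  obtain ⟨r, v, hv, rfl⟩ := exists_spectral h1 h2 hc x
  have hcv : c = ∑ j, (1 : ℝ) • v j := by simp [hc.sum_eq v hv]
  rw [hB.symm, map_sum, LinearMap.sum_apply, map_sum]
  refine Finset.sum_congr rfl fun k _ => ?_
  rw [map_smul, map_smul, LinearMap.smul_apply, hcv, hB.apply_sum hv,
    S.unit_of_mem_states (hv.2.1 k)]

theorem sum_apply_eq_unit (hB : S.IsFrameForm B) (h1 : S.ClassicalDecomposability)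
    (h2 : S.StrongSymmetry) {n : ℕ} {c : A} (hc : S.HasCapacity n c) {v : Fin n → A}
    (hv : S.IsFrame v) (x : A) : ∑ j, B (v j) x = S.unit x := by
  rw [← hB.apply_capacity h1 h2 hc, ← hc.sum_eq v hv, map_sum, LinearMap.sum_apply]

/-- A frame form is positive definite, by the spectral decomposition. -/
theorem eq_zero_of_apply_self_nonpos (hB : S.IsFrameForm B) (h1 : S.ClassicalDecomposability)
    (h2 : S.StrongSymmetry) {n : ℕ} {c : A} (hc : S.HasCapacity n c) {x : A} (hx : B x x ≤ 0) :
    x = 0 := by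
  obtain ⟨r, v, hv, rfl⟩ := exists_spectral h1 h2 hc x
  rw [hB.apply_self hv] at hx
  have h := (Finset.sum_eq_zero_iff_of_nonneg fun j _ => sq_nonneg (r j)).1
    (le_antisymm hx (Finset.sum_nonneg fun j _ => sq_nonneg (r j)))
  refine Finset.sum_eq_zero fun j hj => ?_
  rw [pow_eq_zero_iff two_ne_zero |>.1 (h j hj), zero_smul]

/-- Every functional `e` is diagonal in some frame of maximal size. -/
theorem exists_spectral_dual [FiniteDimensional ℝ A] (hB : S.IsFrameForm B)
    (h1 : S.ClassicalDecomposability) (h2 : S.StrongSymmetry) {n : ℕ} {c : A}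
    (hc : S.HasCapacity n c) (e : A →L[ℝ] ℝ) :
    ∃ v : Fin n → A, S.IsFrame v ∧ ∀ y, e y = B (∑ j, e (v j) • v j) y := by
  have hinj : Function.Injective (B : A →ₗ[ℝ] Module.Dual ℝ A) := by
    refine (injective_iff_map_eq_zero _).2 fun x hx => ?_
    exact hB.eq_zero_of_apply_self_nonpos h1 h2 hc (by rw [hx]; simp)
  have hsurj := (LinearMap.injective_iff_surjective_of_finrank_eq_finrank
    (Subspace.dual_finrank_eq (K := ℝ) (V := A)).symm).1 hinj
  obtain ⟨x, hx⟩ := hsurj (e : A →ₗ[ℝ] ℝ)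
  have he : ∀ y, e y = B x y := fun y => (LinearMap.congr_fun hx y).symm
  obtain ⟨r, v, hv, hxr⟩ := exists_spectral h1 h2 hc x
  have hr : ∀ j, e (v j) = r j := fun j => by rw [he, hB.symm, hxr, hB.apply_sum hv]
  exact ⟨v, hv, fun y => by simp only [hr]; rw [← hxr, he]⟩

/-- For a pure state `w`, the functional `B w` is an allowed effect.  An allowed effect `e` that
singles out `w` in a frame of maximal size has eigenvalues in `[0, 1]` with sum `1`, so its
representing vector has length at most `1`; as its product with the unit vector `w` is `e w = 1`, it
equals `w`. -/
theorem exists_allowed_eq [FiniteDimensional ℝ A] (hB : S.IsFrameForm B)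
    (h1 : S.ClassicalDecomposability) (h2 : S.StrongSymmetry) {n : ℕ} {c : A}
    (hc : S.HasCapacity n c) {w : A} (hw : S.IsPure w) :
    ∃ e ∈ S.allowed, ∀ y, e y = B w y := by
  obtain ⟨k, v', rfl, hv⟩ := (S.isFrame_of_isPure hw).exists_append h2 hc
  have hw0 : Fin.append (fun _ : Fin 1 => w) v' (Fin.castAdd k 0) = w := by simp
  obtain ⟨-, -, e, he, -, hδ⟩ := id hv
  set f := e (Fin.castAdd k 0)
  have hfw : f w = 1 := by
    have h := hδ (Fin.castAdd k 0) (Fin.castAdd k 0)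
    rwa [if_pos rfl, hw0] at h
  have hfc : f c = 1 := by
    rw [← hc.sum_eq _ hv, map_sum]
    simp [f, hδ]
  obtain ⟨x, hx, hfx⟩ := hB.exists_spectral_dual h1 h2 hc f
  set r := fun j => f (x j)
  have hr0 : ∀ j, 0 ≤ r j := fun j => S.allowed_nonneg (he _) (hx.2.1 j)
  have hr1 : ∀ j, r j ≤ 1 := fun j => S.allowed_le_one (he _) (hx.2.1 j)
  have hrs : ∑ j, r j = 1 := by rw [← hfc, ← hc.sum_eq _ hx, map_sum]
  have hsq : ∑ j, r j ^ 2 ≤ 1 := by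
    rw [← hrs]
    exact Finset.sum_le_sum fun j _ => by nlinarith [hr0 j, hr1 j]
  have hxw : B (∑ j, r j • x j) w = 1 := by rw [← hfx, hfw]
  have h0 : (∑ j, r j • x j) - w = 0 := by
    refine hB.eq_zero_of_apply_self_nonpos h1 h2 hc ?_
    have hxx := hB.apply_self hx r
    have hww := hB.apply_pure hw
    have hwx := hB.symm w (∑ j, r j • x j)
    rw [map_sub, map_sub, LinearMap.sub_apply, LinearMap.sub_apply]
    linarith
  refine ⟨f, he _, fun y => ?_⟩
  rw [hfx, sub_eq_zero.1 h0]

theorem apply_nonneg [FiniteDimensional ℝ A] (hB : S.IsFrameForm B)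
    (h1 : S.ClassicalDecomposability) (h2 : S.StrongSymmetry) {n : ℕ} {c : A}
    (hc : S.HasCapacity n c) {w : A} (hw : S.IsPure w) {y : A} (hy : y ∈ S.states) :
    0 ≤ B w y := by
  obtain ⟨e, he, hey⟩ := hB.exists_allowed_eq h1 h2 hc hw
  rw [← hey]
  exact S.allowed_nonneg he hy

/-- Pure states whose effects `B (w j)` sum to at most the unit form a frame. -/
theorem isFrame_of_sum_le [FiniteDimensional ℝ A] (hB : S.IsFrameForm B)
    (h1 : S.ClassicalDecomposability) (h2 : S.StrongSymmetry) {n : ℕ} {c : A}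
    (hc : S.HasCapacity n c) {m : ℕ} {w : Fin m → A} (hw : ∀ j, S.IsPure (w j))
    (hsum : ∀ y ∈ S.states, ∑ j, B (w j) y ≤ S.unit y) : S.IsFrame w := by
  choose e he hey using fun j => hB.exists_allowed_eq h1 h2 hc (hw j)
  refine ⟨hw, fun j => (hw j).1, e, he, fun y hy => by simpa only [hey] using hsum y hy,
    fun j k => ?_⟩
  rw [hey]
  split_ifs with hjk
  · rw [hjk, hB.apply_pure (hw k)]
  · -- the effect of `w k` alone already uses up the unit on the state `w k`
    have h := hsum _ (hw k).1
    have hpair : ∑ i ∈ {j, k}, B (w i) (w k) ≤ ∑ i, B (w i) (w k) :=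
      Finset.sum_le_sum_of_subset_of_nonneg (Finset.subset_univ _)
        fun i _ _ => hB.apply_nonneg h1 h2 hc (hw i) (hw k).1
    rw [Finset.sum_pair hjk, hB.apply_pure (hw k)] at hpair
    rw [S.unit_of_mem_states (hw k).1] at h
    exact le_antisymm (by linarith) (hB.apply_nonneg h1 h2 hc (hw j) (hw k).1)

/-! ### The entropy is well defined -/

/-- The weights of a decomposition are the images of the weights of any other one under the doubly
stochastic matrix `B (w j) (v k)`. -/
theorem shannon_le [FiniteDimensional ℝ A] (hB : S.IsFrameForm B)
    (h1 : S.ClassicalDecomposability) (h2 : S.StrongSymmetry) {n : ℕ} {c : A}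
    (hc : S.HasCapacity n c) {x : A} {p q : Fin n → ℝ} {w v : Fin n → A}
    (hp : S.IsClassicalDecomposition x p w) (hq : S.IsClassicalDecomposition x q v) :
    shannon q ≤ shannon p := by
  have hpj : ∀ j, p j = ∑ k, B (w j) (v k) * q k := fun j => by
    rw [← hB.apply_sum hp.2.1 p j, ← hp.2.2, hq.2.2, map_sum]
    exact Finset.sum_congr rfl fun k _ => by rw [map_smul, smul_eq_mul, mul_comm]
  have hrow : ∀ j, ∑ k, B (w j) (v k) = 1 := fun j => by
    rw [Finset.sum_congr rfl fun k _ => hB.symm (w j) (v k),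
      hB.sum_apply_eq_unit h1 h2 hc hq.2.1, S.unit_of_mem_states (hp.2.1.2.1 j)]
  have hcol : ∀ k, ∑ j, B (w j) (v k) = 1 := fun k => by
    rw [hB.sum_apply_eq_unit h1 h2 hc hp.2.1, S.unit_of_mem_states (hq.2.1.2.1 k)]
  have hsh : ∀ r : Fin n → ℝ, shannon r = ∑ j, Real.negMulLog (r j) := fun r => by
    simp [shannon, Real.negMulLog]
  rw [hsh, hsh]
  calc ∑ k, Real.negMulLog (q k)
      = ∑ k, ∑ j, B (w j) (v k) * Real.negMulLog (q k) := by
        simp only [← Finset.sum_mul, hcol, one_mul]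
    _ = ∑ j, ∑ k, B (w j) (v k) • Real.negMulLog (q k) := Finset.sum_comm
    _ ≤ ∑ j, Real.negMulLog (∑ k, B (w j) (v k) • q k) :=
        Finset.sum_le_sum fun j _ => Real.concaveOn_negMulLog.le_map_sum
          (fun k _ => hB.apply_nonneg h1 h2 hc (hp.2.1.1 j) (hq.2.1.2.1 k)) (hrow j)
          fun k _ => hq.1.1 k
    _ = ∑ j, Real.negMulLog (p j) := by simp only [smul_eq_mul, ← hpj]

theorem entropy_eq_shannon [FiniteDimensional ℝ A] (hB : S.IsFrameForm B)
    (h1 : S.ClassicalDecomposability) (h2 : S.StrongSymmetry) {n : ℕ} {c : A}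
    (hc : S.HasCapacity n c) {x : A} {m : ℕ} {q : Fin m → ℝ} {v : Fin m → A}
    (hq : S.IsClassicalDecomposition x q v) : S.entropy x = shannon q := by
  have hex : ∃ s, S.IsEntropyValue x s := ⟨_, m, q, v, hq, rfl⟩
  have hS : S.entropy x = hex.choose := dif_pos hex
  obtain ⟨l, p, w, hp, hs⟩ := hex.choose_spec
  obtain ⟨p', w', hp', hpp⟩ := hp.exists_capacity h2 hc
  obtain ⟨q', v', hq', hqq⟩ := hq.exists_capacity h2 hc
  rw [hS, hs, ← hpp, ← hqq]
  exact le_antisymm (hB.shannon_le h1 h2 hc hq' hp') (hB.shannon_le h1 h2 hc hp' hq')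

/-- The entropy of a decomposition indexed by an arbitrary finite type. -/
theorem entropy_sum_eq [FiniteDimensional ℝ A] (hB : S.IsFrameForm B)
    (h1 : S.ClassicalDecomposability) (h2 : S.StrongSymmetry) {n : ℕ} {c : A}
    (hc : S.HasCapacity n c) {ι : Type*} [Fintype ι] {q : ι → ℝ} (hq0 : ∀ i, 0 ≤ q i)
    (hq1 : ∑ i, q i = 1) {v : ι → A} (hv : ∀ i, S.IsPure (v i))
    (hsum : ∀ y ∈ S.states, ∑ i, B (v i) y ≤ S.unit y) :
    S.entropy (∑ i, q i • v i) = ∑ i, Real.negMulLog (q i) := by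
  let σ := (Fintype.equivFin ι).symm
  have hdec : S.IsClassicalDecomposition (∑ i, q i • v i) (q ∘ σ) (v ∘ σ) := by
    refine ⟨⟨fun j => hq0 _, ?_⟩, hB.isFrame_of_sum_le h1 h2 hc (fun j => hv _) fun y hy => ?_, ?_⟩
    · rw [← hq1]; exact Equiv.sum_comp σ q
    · exact (Equiv.sum_comp σ fun i => B (v i) y).trans_le (hsum y hy)
    · exact (Equiv.sum_comp σ fun i => q i • v i).symm
  rw [hB.entropy_eq_shannon h1 h2 hc hdec, ← Equiv.sum_comp σ]
  simp [shannon, Real.negMulLog]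

/-! ### Decompositions into perfectly distinguishable mixed states -/

/-- If an allowed effect `e` is certain to occur on the state `w`, then `w` is a mixture of a frame
whose effects sum to at most `e`.

Diagonalize `e` and let `P` be the sum of its eigenvectors `y j` of eigenvalue `1`; then `w` is
orthogonal to the other eigenvectors.  Diagonalize `P + w` and let `Q` be the sum of its
eigenvectors `x i` of positive eigenvalue.  Summing the products `B (x i) (y j)` in two ways gives
`B P P = B P Q = B Q Q`, so `P = Q`, and `w = (P + w) - Q` is diagonal in the `x i`. -/
theorem exists_frame_of_certain [FiniteDimensional ℝ A] (hB : S.IsFrameForm B)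
    (h1 : S.ClassicalDecomposability) (h2 : S.StrongSymmetry) {n : ℕ} {c : A}
    (hc : S.HasCapacity n c) {e : A →L[ℝ] ℝ} (he : e ∈ S.allowed) {w : A} (hw : w ∈ S.states)
    (hew : e w = 1) :
    ∃ (m : ℕ) (q : Fin m → ℝ) (x : Fin m → A), S.IsClassicalDecomposition w q x ∧
      ∀ y ∈ S.states, ∑ i, B (x i) y ≤ e y := by
  classical
  obtain ⟨y, hy, hey⟩ := hB.exists_spectral_dual h1 h2 hc e
  have hB0 : ∀ {v z}, S.IsPure v → z ∈ S.states → 0 ≤ B v z :=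
    fun hv hz => hB.apply_nonneg h1 h2 hc hv hz
  have he0 : ∀ j, 0 ≤ e (y j) := fun j => S.allowed_nonneg he (hy.2.1 j)
  have he1 : ∀ j, e (y j) ≤ 1 := fun j => S.allowed_le_one he (hy.2.1 j)
  have hey' : ∀ z, e z = ∑ j, e (y j) * B (y j) z := fun z => by
    conv_lhs => rw [hey, map_sum, LinearMap.sum_apply]
    exact Finset.sum_congr rfl fun j _ => by simp
  set J := Finset.univ.filter fun j => e (y j) = 1
  have hyw : ∀ j ∉ J, B (y j) w = 0 := by
    intro j hj
    have hj' : e (y j) ≠ 1 := by simpa [J] using hj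
    have hs : ∑ j, (1 - e (y j)) * B (y j) w = 0 := by
      simp only [sub_mul, one_mul, Finset.sum_sub_distrib]
      rw [← hey', hew, hB.sum_apply_eq_unit h1 h2 hc hy, S.unit_of_mem_states hw, sub_self]
    have h := (Finset.sum_eq_zero_iff_of_nonneg fun i _ =>
      mul_nonneg (sub_nonneg.2 (he1 i)) (hB0 (hy.1 i) hw)).1 hs j (Finset.mem_univ j)
    exact (mul_eq_zero.1 h).resolve_left (sub_ne_zero.2 hj'.symm)
  set P := ∑ j ∈ J, y j with hP
  obtain ⟨r, x, hx, hPw⟩ := exists_spectral h1 h2 hc (P + w)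
  have hxP : ∀ i, B (x i) P = ∑ j ∈ J, B (x i) (y j) := fun i => by rw [hP, map_sum]
  have hr : ∀ i, r i = B (x i) P + B (x i) w := fun i => by
    rw [← map_add, hPw, hB.apply_sum hx]
  have hxy0 : ∀ i j, 0 ≤ B (x i) (y j) := fun i j => hB0 (hx.1 i) (hy.2.1 j)
  have hxP0 : ∀ i, 0 ≤ B (x i) P := fun i => by
    rw [hxP]; exact Finset.sum_nonneg fun j _ => hxy0 i j
  have hr0 : ∀ i, 0 ≤ r i := fun i => by
    rw [hr]; exact add_nonneg (hxP0 i) (hB0 (hx.1 i) hw)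
  set I := Finset.univ.filter fun i => 0 < r i
  have hI : ∀ i ∉ I, r i = 0 := fun i hi =>
    le_antisymm (by simpa [I] using hi) (hr0 i)
  -- `B (x i) (y j)` vanishes if exactly one of `i ∈ I`, `j ∈ J` holds, so the rows and the columns of
  -- the `I × J` block sum to `1`
  have hrow : ∀ i ∈ I, ∑ j ∈ J, B (x i) (y j) = 1 := by
    intro i hi
    rw [← S.unit_of_mem_states (hx.2.1 i), ← hB.sum_apply_eq_unit h1 h2 hc hy (x i)]
    simp only [hB.symm (x i)]
    refine Finset.sum_subset (Finset.subset_univ _) fun j _ hj => ?_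
    have h0 : B (y j) (P + w) = 0 := by
      rw [map_add, hyw j hj, add_zero, hP, map_sum]
      refine Finset.sum_eq_zero fun k hk => ?_
      rw [hB.frame hy, if_neg]
      rintro rfl
      exact hj hk
    rw [hPw, map_sum] at h0
    have h := (Finset.sum_eq_zero_iff_of_nonneg fun i _ => by
      rw [map_smul, smul_eq_mul]
      exact mul_nonneg (hr0 i) (hB0 (hy.1 j) (hx.2.1 i))).1 h0 i (Finset.mem_univ i)
    rw [map_smul, smul_eq_mul] at h
    exact (mul_eq_zero.1 h).resolve_left (by simpa [I] using hi : 0 < r i).ne'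
  have hcol : ∀ j ∈ J, ∑ i ∈ I, B (x i) (y j) = 1 := by
    intro j hj
    rw [← S.unit_of_mem_states (hy.2.1 j), ← hB.sum_apply_eq_unit h1 h2 hc hx (y j)]
    refine Finset.sum_subset (Finset.subset_univ _) fun i _ hi => ?_
    have h := hr i
    rw [hI i hi] at h
    have h0 : B (x i) P = 0 := by linarith [hxP0 i, hB0 (hx.1 i) hw]
    rw [hxP] at h0
    exact (Finset.sum_eq_zero_iff_of_nonneg fun j _ => hxy0 i j).1 h0 j hj
  have hframe : ∀ {v : Fin n → A} (K : Finset (Fin n)), S.IsFrame v →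
      B (∑ i ∈ K, v i) (∑ i ∈ K, v i) = K.card := fun K hv => by
    simp [map_sum, LinearMap.sum_apply, hB.frame hv]
  set Q := ∑ i ∈ I, x i with hQ
  have hQP : B Q P = I.card := by
    rw [hQ, LinearMap.map_sum₂, Finset.sum_congr rfl fun i hi => (hxP i).trans (hrow i hi)]
    simp
  have hQP' : B Q P = J.card := by
    rw [hQ, LinearMap.map_sum₂, Finset.sum_congr rfl fun i _ => hxP i, Finset.sum_comm,
      Finset.sum_congr rfl hcol]
    simp
  have hPQ : P = Q := by
    refine sub_eq_zero.1 (hB.eq_zero_of_apply_self_nonpos h1 h2 hc ?_)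
    have hPP := hframe J hy
    have hQQ := hframe I hx
    rw [map_sub, map_sub, LinearMap.sub_apply, LinearMap.sub_apply, hB.symm P Q]
    linarith
  have hwx : w = ∑ i ∈ I, B (x i) w • x i := by
    have h : ∑ i, r i • x i = ∑ i ∈ I, r i • x i :=
      (Finset.sum_subset (Finset.subset_univ _) fun i _ hi => by rw [hI i hi, zero_smul]).symm
    have h' : ∑ i ∈ I, r i • x i = Q + ∑ i ∈ I, B (x i) w • x i := by
      rw [hQ, ← Finset.sum_add_distrib]
      refine Finset.sum_congr rfl fun i hi => ?_
      rw [hr, hxP, hrow i hi, add_smul, one_smul]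
    rw [h, h', hPQ] at hPw
    exact add_left_cancel hPw
  let σ := I.equivFin.symm
  refine ⟨I.card, fun k => B (x (σ k)) w, fun k => x (σ k), ⟨⟨fun k => hB0 (hx.1 _) hw, ?_⟩,
    hx.comp (f := fun k => (σ k : Fin n)) (Subtype.val_injective.comp σ.injective), ?_⟩,
    fun z hz => ?_⟩
  · rw [sum_equivFin_symm I fun i => B (x i) w, ← S.unit_of_mem_states hw]
    conv_rhs => rw [hwx]
    simp [S.unit_of_mem_states (hx.2.1 _)]
  · exact hwx.trans (sum_equivFin_symm I fun i => B (x i) w • x i).symm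
  · rw [sum_equivFin_symm I fun i => B (x i) z, ← LinearMap.sum_apply, ← map_sum, ← hQ,
      ← hPQ, hey', hP, map_sum, LinearMap.sum_apply]
    calc ∑ j ∈ J, B (y j) z = ∑ j ∈ J, e (y j) * B (y j) z :=
          Finset.sum_congr rfl fun j hj => by
            rw [(by simpa [J] using hj : e (y j) = 1), one_mul]
      _ ≤ ∑ j, e (y j) * B (y j) z :=
          Finset.sum_le_sum_of_subset_of_nonneg (Finset.subset_univ _)
            fun j _ _ => mul_nonneg (he0 j) (hB0 (hy.1 j) hz)

/-- The decompositions of the `w j` given by the effects that distinguish them fit together to a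
decomposition of their mixture. -/
theorem entropy_mixture [FiniteDimensional ℝ A] (hB : S.IsFrameForm B)
    (h1 : S.ClassicalDecomposability) (h2 : S.StrongSymmetry) {n : ℕ} {c : A}
    (hc : S.HasCapacity n c) {m : ℕ} {p : Fin m → ℝ} {w : Fin m → A} (hp : IsProbDist p)
    (hw : S.PerfectlyDistinguishable w) :
    S.entropy (∑ j, p j • w j) = ∑ j, p j * S.entropy (w j) - ∑ j, p j * Real.log (p j) := by
  obtain ⟨hws, e, he, hsum, hδ⟩ := hw
  choose l q x hdec hle using fun j =>
    hB.exists_frame_of_certain h1 h2 hc (he j) (hws j) (by simp [hδ])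
  have hmix : ∑ j, p j • w j = ∑ i : (j : Fin m) × Fin (l j), (p i.1 * q i.1 i.2) • x i.1 i.2 := by
    rw [Fintype.sum_sigma]
    refine Finset.sum_congr rfl fun j _ => ?_
    conv_lhs => rw [(hdec j).2.2, Finset.smul_sum]
    simp only [mul_smul]
  rw [hmix, hB.entropy_sum_eq h1 h2 hc (q := fun i : (j : Fin m) × Fin (l j) => p i.1 * q i.1 i.2)
    (v := fun i => x i.1 i.2) (fun i => mul_nonneg (hp.1 _) ((hdec _).1.1 _)) ?_
    (fun i => (hdec _).2.1.1 _) fun y hy => ?_]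
  · rw [Fintype.sum_sigma, ← Finset.sum_sub_distrib]
    refine Finset.sum_congr rfl fun j _ => ?_
    simp only [Real.negMulLog_mul, Finset.sum_add_distrib]
    rw [← Finset.sum_mul, ← Finset.mul_sum, (hdec j).1.2, hB.entropy_eq_shannon h1 h2 hc (hdec j)]
    simp [shannon, Real.negMulLog]
    ring
  · rw [Fintype.sum_sigma]
    simp only [← Finset.mul_sum, (hdec _).1.2, mul_one, hp.2]
  · rw [Fintype.sum_sigma]
    exact (Finset.sum_le_sum fun j _ => hle j y hy).trans (hsum y hy)

end IsFrameForm

end DynamicalStateSpace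

end GPT

/-- Under classical decomposability and strong symmetry the entropy is well defined (every
classical decomposition of a state yields it), and it is compatible with all decompositions into
perfectly distinguishable, possibly mixed, states. -/
theorem mainTheorem2 {A : Type*} [NormedAddCommGroup A] [NormedSpace ℝ A] [FiniteDimensional ℝ A]
    (S : GPT.DynamicalStateSpace A)
    (h1 : S.ClassicalDecomposability) (h2 : S.StrongSymmetry) :
    (∀ (x : A) (n : ℕ) (q : Fin n → ℝ) (v : Fin n → A),
      S.IsClassicalDecomposition x q v → S.entropy x = -∑ j, q j * Real.log (q j)) ∧
    ∀ (n : ℕ) (p : Fin n → ℝ) (w : Fin n → A),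
      GPT.IsProbDist p → S.PerfectlyDistinguishable w →
        S.entropy (∑ j, p j • w j) =
          ∑ j, p j * S.entropy (w j) - ∑ j, p j * Real.log (p j) := by
  obtain ⟨N, c, hc⟩ := S.exists_hasCapacity h1 h2
  obtain ⟨B, hB⟩ := S.exists_isFrameForm h2 hc
  exact ⟨fun x n q v h => hB.entropy_eq_shannon h1 h2 hc h,
    fun n p w hp hw => hB.entropy_mixture h1 h2 hc hp hw⟩
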